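/- Let $H$ be a complex Hilbert space and let $B$ be a bounded positive operator on $H$. Order bounded operators by $S\le T$ iff $T-S$ is positive. Let $H_B$ be the completion of the range of $B$ with respect to the inner product $\langle Bx,By\rangle_B=\langle Bx,y\rangle$, let $J_B:H_B\to H$ be the continuous extension of the inclusion $Bx\mapsto Bx$, and let $\mathbf P(H_B)$ be the lattice of orthogonal projections of $H_B$. For bounded positive operators $A,C$ on $H$ let $A:C$ denote their parallel sum, the unique bounded operator with $$\langle (A:C)x,x\rangle=\inf_{y\in H}\big\{\langle A(x-y),x-y\rangle+\langle Cy,y\rangle\big\}\qquad(x\in H),$$ and let $[A]B=\sup_{n\in\mathbb N}\,B:(nA)$ (supremum in the operator order). A positive operator $A\le B$ is called a $B$-quasi-unit if $[A]B=A$; let $\mathbf Q(B)$ be the set of $B$-quasi-units, and let $[0,B]=\{A: 0\le A\le B\}$. **Theorem.** The map $\Psi_B(P):=J_BPJ_B^*$ is a bijection from $\mathbf P(H_B)$ onto $\mathbf Q(B)$, and both $\Psi_B$ and its inverse are order preserving, that is, $P\le Q$ if and only if $\Psi_B(P)\le\Psi_B(Q)$ for all $P,Q\in\mathbf P(H_B)$.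 Moreover, $$\mathbf Q(B)=\operatorname{ex}[0,B]=\{[A]B : A \text{ a bounded positive operator on } H\},$$ where $\operatorname{ex}$ denotes the set of extreme points. -/

import Mathlib

open Filter Topology

set_option linter.unusedSectionVars false

namespace QuasiUnit

section AuxiliarySpace

/-- The orthogonal projections of a Hilbert space. They are ordered as operators. -/
def projections (K : Type*) [NormedAddCommGroup K] [InnerProductSpace ℂ K] [CompleteSpace K] :
    Set (K →L[ℂ] K) := {P | IsStarProjection P}

variable {H : Type*} [NormedAddCommGroup H] [InnerProductSpace ℂ H]

/-- The range of a positive operator `B`, as a bare vector space. It is a type synonym, because it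
carries the inner product `⟨Bx, By⟩_B = ⟨Bx, y⟩` below and not the one inherited from `H`. -/
def RangeSpace (B : H →L[ℂ] H) (_hB : B.IsPositive) : Type _ := LinearMap.range B.toLinearMap

namespace RangeSpace

variable (B : H →L[ℂ] H) (hB : B.IsPositive)

instance : AddCommGroup (RangeSpace B hB) :=
  inferInstanceAs (AddCommGroup (LinearMap.range B.toLinearMap))

instance : Module ℂ (RangeSpace B hB) :=
  inferInstanceAs (Module ℂ (LinearMap.range B.toLinearMap))

/-- The inclusion of the range into `H`. -/
def incl : RangeSpace B hB →ₗ[ℂ] H := (LinearMap.range B.toLinearMap).subtype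

/-- The vector `Bx`, as an element of the range. -/
def mk : H →ₗ[ℂ] RangeSpace B hB := B.toLinearMap.rangeRestrict

theorem incl_mk (x : H) : incl B hB (mk B hB x) = B x := rfl

theorem incl_injective : Function.Injective (incl B hB) := Subtype.val_injective

theorem mk_surjective : Function.Surjective (mk B hB) := B.toLinearMap.surjective_rangeRestrict

/-- A vector `y` with `By = v`. -/
noncomputable def preimage (v : RangeSpace B hB) : H := (mk_surjective B hB v).choose

theorem mk_preimage (v : RangeSpace B hB) : mk B hB (preimage B hB v) = v :=
  (mk_surjective B hB v).choose_spec

theorem apply_preimage (v : RangeSpace B hB) : B (preimage B hB v) = incl B hB v := by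
  rw [← incl_mk B hB, mk_preimage]

theorem inner_preimage (u : RangeSpace B hB) (y : H) :
    inner ℂ (incl B hB u) (preimage B hB (mk B hB y)) = inner ℂ (incl B hB u) y := by
  obtain ⟨x, rfl⟩ := mk_surjective B hB u
  rw [incl_mk, hB.inner_left_eq_inner_right, hB.inner_left_eq_inner_right, apply_preimage, incl_mk]

end RangeSpace

variable [CompleteSpace H]

theorem norm_sq_apply_le {C : H →L[ℂ] H} (hC : C.IsPositive) (x : H) :
    ‖C x‖ ^ 2 ≤ ‖C‖ * C.reApplyInnerSelf x := by
  have h0 : 0 ≤ C := (ContinuousLinearMap.nonneg_iff_isPositive C).2 hC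
  have hs : (CFC.sqrt C).IsPositive :=
    (ContinuousLinearMap.nonneg_iff_isPositive _).1 (CFC.sqrt_nonneg C)
  have hm : ∀ y, CFC.sqrt C (CFC.sqrt C y) = C y := fun y => by
    conv_rhs => rw [← CFC.sqrt_mul_sqrt_self C h0]
    rfl
  have h1 : C.reApplyInnerSelf x = ‖CFC.sqrt C x‖ ^ 2 := by
    rw [ContinuousLinearMap.reApplyInnerSelf_apply, ← hm x, hs.inner_left_eq_inner_right,
      inner_self_eq_norm_sq]
  have h2 : ‖CFC.sqrt C‖ * ‖CFC.sqrt C‖ = ‖C‖ := by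
    rw [← CStarRing.norm_star_mul_self, hs.isSelfAdjoint.star_eq, CFC.sqrt_mul_sqrt_self C h0]
  have h3 : ‖C x‖ ≤ ‖CFC.sqrt C‖ * ‖CFC.sqrt C x‖ := by
    rw [← hm x]; exact ContinuousLinearMap.le_opNorm _ _
  calc ‖C x‖ ^ 2 ≤ (‖CFC.sqrt C‖ * ‖CFC.sqrt C x‖) ^ 2 := by gcongr
    _ = ‖C‖ * C.reApplyInnerSelf x := by rw [h1, ← h2]; ring

namespace RangeSpace

variable (B : H →L[ℂ] H) (hB : B.IsPositive)

/-- The inner product `⟨Bx, By⟩_B = ⟨Bx, y⟩` on the range of `B`. -/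
@[reducible]
noncomputable def core : InnerProductSpace.Core ℂ (RangeSpace B hB) where
  inner u v := inner ℂ (incl B hB u) (preimage B hB v)
  conj_inner_symm u v := by
    obtain ⟨x, rfl⟩ := mk_surjective B hB u
    obtain ⟨y, rfl⟩ := mk_surjective B hB v
    rw [inner_preimage, inner_preimage, inner_conj_symm, incl_mk, incl_mk,
      hB.inner_left_eq_inner_right]
  re_inner_nonneg u := by
    obtain ⟨x, rfl⟩ := mk_surjective B hB u
    rw [inner_preimage, incl_mk]
    exact hB.re_inner_nonneg_left x
  add_left u v w := by rw [map_add, inner_add_left]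
  smul_left u v r := by rw [map_smul, inner_smul_left]
  definite u hu := by
    obtain ⟨x, rfl⟩ := mk_surjective B hB u
    rw [inner_preimage, incl_mk] at hu
    have h := norm_sq_apply_le hB x
    rw [ContinuousLinearMap.reApplyInnerSelf_apply, hu] at h
    have h' : B x = 0 := by
      have : ‖B x‖ ^ 2 ≤ 0 := by simpa using h
      simpa using this
    exact incl_injective B hB (by rw [incl_mk, h', map_zero])

noncomputable instance : NormedAddCommGroup (RangeSpace B hB) :=
  @InnerProductSpace.Core.toNormedAddCommGroup ℂ _ _ _ _ (core B hB)

noncomputable instance : InnerProductSpace ℂ (RangeSpace B hB) :=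
  InnerProductSpace.ofCore (core B hB).toCore

theorem inner_mk_mk (x y : H) : inner ℂ (mk B hB x) (mk B hB y) = inner ℂ (B x) y := by
  change inner ℂ (incl B hB (mk B hB x)) (preimage B hB (mk B hB y)) = _
  rw [inner_preimage, incl_mk]

theorem norm_incl_le (v : RangeSpace B hB) : ‖incl B hB v‖ ≤ √‖B‖ * ‖v‖ := by
  obtain ⟨x, rfl⟩ := mk_surjective B hB v
  have h := norm_sq_apply_le hB x
  have h2 : ‖mk B hB x‖ ^ 2 = B.reApplyInnerSelf x := by
    rw [← inner_self_eq_norm_sq (𝕜 := ℂ), inner_mk_mk, ContinuousLinearMap.reApplyInnerSelf_apply]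
  rw [incl_mk]
  refine abs_le_of_sq_le_sq' ?_ (by positivity) |>.2
  rw [mul_pow, Real.sq_sqrt (norm_nonneg B), h2]
  exact h

end RangeSpace

variable (B : H →L[ℂ] H) (hB : B.IsPositive)

/-- The auxiliary Hilbert space `H_B`: the completion of the range of `B` with respect to the inner
product `⟨Bx, By⟩_B = ⟨Bx, y⟩`. -/
abbrev AuxSpace : Type _ := UniformSpace.Completion (RangeSpace B hB)

/-- The canonical operator `J_B : H_B → H`, the continuous extension of `Bx ↦ Bx`. -/
noncomputable def J : AuxSpace B hB →L[ℂ] H :=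
  ((RangeSpace.incl B hB).mkContinuous (√‖B‖) (RangeSpace.norm_incl_le B hB)).extend
    UniformSpace.Completion.toComplL

theorem J_coe (v : RangeSpace B hB) : J B hB (v : AuxSpace B hB) = RangeSpace.incl B hB v :=
  ContinuousLinearMap.extend_eq (e := UniformSpace.Completion.toComplL) _
    UniformSpace.Completion.denseRange_coe
    (UniformSpace.Completion.isUniformInducing_coe _) v

theorem J_adjoint_apply (x : H) :
    (J B hB).adjoint x = ((RangeSpace.mk B hB x : RangeSpace B hB) : AuxSpace B hB) := by
  refine ext_inner_left ℂ fun ξ => ?_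
  rw [ContinuousLinearMap.adjoint_inner_right]
  induction ξ using UniformSpace.Completion.induction_on with
  | hp => exact isClosed_eq (by fun_prop) (by fun_prop)
  | ih v =>
    obtain ⟨y, rfl⟩ := RangeSpace.mk_surjective B hB v
    rw [J_coe, UniformSpace.Completion.inner_coe, RangeSpace.inner_mk_mk, RangeSpace.incl_mk]

theorem J_comp_adjoint : J B hB ∘L (J B hB).adjoint = B := by
  ext x
  rw [ContinuousLinearMap.comp_apply, J_adjoint_apply, J_coe, RangeSpace.incl_mk]

/-- The map `Ψ_B(P) = J_B P J_B^*`. -/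
noncomputable def Psi (P : AuxSpace B hB →L[ℂ] AuxSpace B hB) : H →L[ℂ] H :=
  J B hB ∘L P ∘L (J B hB).adjoint

end AuxiliarySpace

section ParallelSum

variable {H : Type*} [NormedAddCommGroup H] [InnerProductSpace ℂ H] [CompleteSpace H]

theorem inner_eq_reApplyInnerSelf {C : H →L[ℂ] H} (hC : C.IsPositive) (x : H) :
    inner ℂ (C x) x = (C.reApplyInnerSelf x : ℂ) :=
  (((ContinuousLinearMap.isPositive_iff_complex C).1 hC x).1).symm

theorem le_of_reApplyInnerSelf_le {C D : H →L[ℂ] H} (hC : C.IsPositive) (hD : D.IsPositive)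
    (h : ∀ x, C.reApplyInnerSelf x ≤ D.reApplyInnerSelf x) : C ≤ D := by
  rw [ContinuousLinearMap.le_def, ContinuousLinearMap.isPositive_iff_complex]
  intro x
  have e : inner ℂ ((D - C) x) x = ((D.reApplyInnerSelf x - C.reApplyInnerSelf x : ℝ) : ℂ) := by
    rw [sub_apply, inner_sub_left, inner_eq_reApplyInnerSelf hC,
      inner_eq_reApplyInnerSelf hD, Complex.ofReal_sub]
  rw [e]
  exact ⟨rfl, sub_nonneg.2 (h x)⟩

/-- For positive operators `A` and `B`, there is exactly one operator whose quadratic form is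
`x ↦ inf_y (⟨A(x - y), x - y⟩ + ⟨By, y⟩)`. -/
theorem existsUnique_parallelSum {A B : H →L[ℂ] H} (hA : A.IsPositive) (hB : B.IsPositive) :
    ∃! C : H →L[ℂ] H, ∀ x : H, inner ℂ (C x) x =
      ((⨅ y : H, (A.reApplyInnerSelf (x - y) + B.reApplyInnerSelf y) : ℝ) : ℂ) := by
  refine existsUnique_of_exists_of_unique ?_ fun C D hC hD => ?_
  · have key : ∀ {T : H →L[ℂ] H} (hT : T.IsPositive) (x : H),
        ‖(J T hT).adjoint x‖ ^ 2 = T.reApplyInnerSelf x := fun {T} hT x => by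
      rw [← inner_self_eq_norm_sq (𝕜 := ℂ), ContinuousLinearMap.adjoint_inner_left,
        ← inner_re_symm, ContinuousLinearMap.reApplyInnerSelf_apply]
      conv_rhs => rw [← J_comp_adjoint T hT]
      rfl
    let e := (WithLp.prodContinuousLinearEquiv 2 ℂ (AuxSpace A hA)
      (AuxSpace B hB)).symm.toContinuousLinearMap
    let u : H →L[ℂ] WithLp 2 (AuxSpace A hA × AuxSpace B hB) :=
      e ∘L ((J A hA).adjoint.prod 0)
    let v : H →L[ℂ] WithLp 2 (AuxSpace A hA × AuxSpace B hB) :=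
      e ∘L ((J A hA).adjoint.prod (-(J B hB).adjoint))
    have huv : ∀ x y, ‖u x - v y‖ ^ 2 = A.reApplyInnerSelf (x - y) + B.reApplyInnerSelf y := by
      intro x y
      rw [WithLp.prod_norm_sq_eq_of_L2, ← key hA, ← key hB, map_sub]
      simp [u, v, e]
    let M := (LinearMap.range v.toLinearMap).topologicalClosure
    refine ⟨u.adjoint ∘L Mᗮ.starProjection ∘L u, fun x => ?_⟩
    have h1 : inner ℂ ((u.adjoint ∘L Mᗮ.starProjection ∘L u) x) x =
        ((‖Mᗮ.starProjection (u x)‖ ^ 2 : ℝ) : ℂ) := by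
      have h : Mᗮ.starProjection (Mᗮ.starProjection (u x)) = Mᗮ.starProjection (u x) :=
        Submodule.starProjection_eq_self_iff.2 (Submodule.starProjection_apply_mem _ _)
      rw [ContinuousLinearMap.comp_apply, ContinuousLinearMap.adjoint_inner_left,
        ContinuousLinearMap.comp_apply, ← h, Submodule.inner_starProjection_left_eq_right, h,
        inner_self_eq_norm_sq_to_K]
      simp
    rw [h1, Submodule.starProjection_orthogonal']
    congr 1
    simp_rw [← huv]
    have hmem : M.starProjection (u x) ∈ M := Submodule.starProjection_apply_mem _ _
    have hv : ∀ y, v y ∈ M := fun y => Submodule.le_topologicalClosure _ ⟨y, rfl⟩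
    refine (ciInf_eq_of_forall_ge_of_forall_gt_exists_lt (fun y => ?_) fun w hw => ?_).symm
    · have h2 := ciInf_le (f := fun z : M => ‖u x - z‖) ⟨0, by rintro _ ⟨z, rfl⟩; positivity⟩
        ⟨v y, hv y⟩
      rw [← Submodule.starProjection_minimal] at h2
      exact pow_le_pow_left₀ (norm_nonneg _) h2 2
    · have hc : Continuous fun z => ‖u x - z‖ ^ 2 := by fun_prop
      have hcl : M.starProjection (u x) ∈ closure (Set.range v) := by
        have : (M : Set _) = closure (Set.range v) := by
          rw [Submodule.topologicalClosure_coe]; rfl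
        exact this ▸ hmem
      obtain ⟨_, hz, y, rfl⟩ := mem_closure_iff.1 hcl _ (hc.isOpen_preimage _ (isOpen_Iio (a := w)))
        hw
      exact ⟨y, hz⟩
  · refine ContinuousLinearMap.coe_injective ((ext_inner_map _ _).1 fun x => ?_)
    exact (hC x).trans (hD x).symm

variable {A B : H →L[ℂ] H}

/-- The parallel sum `A : B` of two positive operators, the unique operator with quadratic form
`⟨(A : B)x, x⟩ = inf_y (⟨A(x - y), x - y⟩ + ⟨By, y⟩)`. -/
noncomputable def parallelSum (hA : A.IsPositive) (hB : B.IsPositive) : H →L[ℂ] H :=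
  (existsUnique_parallelSum hA hB).choose

theorem inner_parallelSum (hA : A.IsPositive) (hB : B.IsPositive) (x : H) :
    inner ℂ (parallelSum hA hB x) x =
      ((⨅ y : H, (A.reApplyInnerSelf (x - y) + B.reApplyInnerSelf y) : ℝ) : ℂ) :=
  (existsUnique_parallelSum hA hB).choose_spec.1 x

theorem reApplyInnerSelf_parallelSum (hA : A.IsPositive) (hB : B.IsPositive) (x : H) :
    (parallelSum hA hB).reApplyInnerSelf x =
      ⨅ y : H, (A.reApplyInnerSelf (x - y) + B.reApplyInnerSelf y) := by
  rw [ContinuousLinearMap.reApplyInnerSelf_apply, inner_parallelSum]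
  exact Complex.ofReal_re _

theorem parallelSum_isPositive (hA : A.IsPositive) (hB : B.IsPositive) :
    (parallelSum hA hB).IsPositive := by
  rw [ContinuousLinearMap.isPositive_iff_complex]
  intro x
  rw [inner_parallelSum]
  refine ⟨rfl, ?_⟩
  change 0 ≤ ⨅ y : H, (A.reApplyInnerSelf (x - y) + B.reApplyInnerSelf y)
  exact Real.iInf_nonneg fun y =>
    add_nonneg (hA.re_inner_nonneg_left _) (hB.re_inner_nonneg_left _)

theorem bddBelow_parallelSum (hA : A.IsPositive) (hB : B.IsPositive) (x : H) :
    BddBelow (Set.range fun y : H => A.reApplyInnerSelf (x - y) + B.reApplyInnerSelf y) :=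
  ⟨0, by
    rintro _ ⟨y, rfl⟩
    exact add_nonneg (hA.re_inner_nonneg_left _) (hB.re_inner_nonneg_left _)⟩

theorem parallelSum_le (hA : A.IsPositive) (hB : B.IsPositive) : parallelSum hA hB ≤ A := by
  refine le_of_reApplyInnerSelf_le (parallelSum_isPositive hA hB) hA fun x => ?_
  rw [reApplyInnerSelf_parallelSum]
  refine (ciInf_le (bddBelow_parallelSum hA hB x) 0).trans (le_of_eq ?_)
  simp [ContinuousLinearMap.reApplyInnerSelf_apply]

theorem nsmul_isPositive (hA : A.IsPositive) (n : ℕ) : (n • A).IsPositive :=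
  (ContinuousLinearMap.nonneg_iff_isPositive _).1
    (nsmul_nonneg ((ContinuousLinearMap.nonneg_iff_isPositive _).2 hA) n)

theorem parallelSum_nsmul_mono (hA : A.IsPositive) (hB : B.IsPositive) :
    Monotone fun n : ℕ => parallelSum hB (nsmul_isPositive hA n) := by
  intro m n hmn
  refine le_of_reApplyInnerSelf_le (parallelSum_isPositive _ _) (parallelSum_isPositive _ _)
    fun x => ?_
  rw [reApplyInnerSelf_parallelSum, reApplyInnerSelf_parallelSum]
  refine ciInf_mono (bddBelow_parallelSum hB (nsmul_isPositive hA m) x) fun y => ?_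
  have e : ∀ k : ℕ, (k • A).reApplyInnerSelf y = k * A.reApplyInnerSelf y := fun k => by
    simp [ContinuousLinearMap.reApplyInnerSelf_apply, ← Nat.cast_smul_eq_nsmul ℂ, inner_smul_left]
  have h0 : 0 ≤ A.reApplyInnerSelf y := hA.re_inner_nonneg_left _
  rw [e, e]
  gcongr

/-- A bounded increasing sequence of positive operators has a least upper bound. -/
theorem exists_isLUB_of_monotone {T : ℕ → H →L[ℂ] H} (hT : Monotone T)
    (h0 : ∀ n, (T n).IsPositive) {S : H →L[ℂ] H} (hS : ∀ n, T n ≤ S) :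
    ∃ C, IsLUB (Set.range T) C := by
  have hS0 : S.IsPositive := (ContinuousLinearMap.nonneg_iff_isPositive _).1
    (((ContinuousLinearMap.nonneg_iff_isPositive _).2 (h0 0)).trans (hS 0))
  have hsub : ∀ (C D : H →L[ℂ] H) (x : H),
      (D - C).reApplyInnerSelf x = D.reApplyInnerSelf x - C.reApplyInnerSelf x := fun C D x => by
    simp [ContinuousLinearMap.reApplyInnerSelf_apply, inner_sub_left]
  have hle : ∀ {C D : H →L[ℂ] H}, C ≤ D → ∀ x, C.reApplyInnerSelf x ≤ D.reApplyInnerSelf x :=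
    fun {C D} h x => by
      have := ((ContinuousLinearMap.le_def _ _).1 h).re_inner_nonneg_left x
      rw [← ContinuousLinearMap.reApplyInnerSelf_apply, hsub] at this
      linarith
  have hconv : ∀ x, ∃ z, Tendsto (fun n => T n x) atTop (𝓝 z) := by
    intro x
    refine cauchySeq_tendsto_of_complete ?_
    have hq : CauchySeq fun n => (T n).reApplyInnerSelf x :=
      (tendsto_atTop_ciSup (fun m n hmn => hle (hT hmn) x)
        ⟨S.reApplyInnerSelf x, by rintro _ ⟨n, rfl⟩; exact hle (hS n) x⟩).cauchySeq
    have hb : ∀ m n, m ≤ n → ‖T n x - T m x‖ ^ 2 ≤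
        ‖S‖ * ((T n).reApplyInnerSelf x - (T m).reApplyInnerSelf x) := by
      intro m n hmn
      have hp : (T n - T m).IsPositive := (ContinuousLinearMap.le_def _ _).1 (hT hmn)
      have h1 := norm_sq_apply_le hp x
      rw [sub_apply, hsub] at h1
      have h2 : T n - T m ≤ S := (sub_le_self _
        ((ContinuousLinearMap.nonneg_iff_isPositive _).2 (h0 m))).trans (hS n)
      have h3 : ‖T n - T m‖ ≤ ‖S‖ := CStarAlgebra.norm_le_norm_of_nonneg_of_le
        ((ContinuousLinearMap.nonneg_iff_isPositive _).2 hp) h2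
      exact h1.trans (mul_le_mul_of_nonneg_right h3 (sub_nonneg.2 (hle (hT hmn) x)))
    rw [Metric.cauchySeq_iff'] at hq ⊢
    intro ε hε
    obtain ⟨N, hN⟩ := hq (ε ^ 2 / (‖S‖ + 1)) (by positivity)
    refine ⟨N, fun n hn => ?_⟩
    have h1 := hb N n hn
    have h2 := hN n hn
    rw [Real.dist_eq] at h2
    have h3 := (le_abs_self _).trans_lt h2
    have h5 : 0 ≤ (T n).reApplyInnerSelf x - (T N).reApplyInnerSelf x :=
      sub_nonneg.2 (hle (hT hn) x)
    rw [lt_div_iff₀ (by positivity)] at h3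
    have h4 : ‖T n x - T N x‖ ^ 2 < ε ^ 2 := by nlinarith
    rw [dist_eq_norm]
    exact lt_of_pow_lt_pow_left₀ 2 hε.le h4
  choose f hf using hconv
  let C : H →L[ℂ] H := continuousLinearMapOfTendsto T (tendsto_pi_nhds.2 hf)
  have hC : ∀ x, Tendsto (fun n => (T n).reApplyInnerSelf x) atTop (𝓝 (C.reApplyInnerSelf x)) :=
    fun x => by
      have : Tendsto (fun n => inner ℂ (T n x) x) atTop (𝓝 (inner ℂ (C x) x)) :=
        (hf x).inner tendsto_const_nhds
      exact (Complex.continuous_re.tendsto _).comp this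
  have hCpos : C.IsPositive := by
    rw [ContinuousLinearMap.isPositive_iff_complex]
    intro x
    have h1 : Tendsto (fun n => inner ℂ (T n x) x) atTop (𝓝 (inner ℂ (C x) x)) :=
      (hf x).inner tendsto_const_nhds
    simp_rw [inner_eq_reApplyInnerSelf (h0 _)] at h1
    have h2 := (Complex.continuous_ofReal.tendsto _).comp (hC x)
    exact ⟨tendsto_nhds_unique h2 h1,
      ge_of_tendsto' (hC x) fun n => (h0 n).re_inner_nonneg_left x⟩
  refine ⟨C, ?_, fun D hD => ?_⟩
  · rintro _ ⟨n, rfl⟩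
    refine le_of_reApplyInnerSelf_le (h0 n) hCpos fun x => ?_
    exact ge_of_tendsto (hC x) (eventually_atTop.2 ⟨n, fun m hm => hle (hT hm) x⟩)
  · have hD0 : D.IsPositive := (ContinuousLinearMap.nonneg_iff_isPositive _).1
      (((ContinuousLinearMap.nonneg_iff_isPositive _).2 (h0 0)).trans (hD ⟨0, rfl⟩))
    exact le_of_reApplyInnerSelf_le hCpos hD0 fun x =>
      le_of_tendsto' (hC x) fun n => hle (hD ⟨n, rfl⟩) x

theorem exists_isLUB_parallelSum (hA : A.IsPositive) (hB : B.IsPositive) :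
    ∃ C, IsLUB (Set.range fun n : ℕ => parallelSum hB (nsmul_isPositive hA n)) C :=
  exists_isLUB_of_monotone (parallelSum_nsmul_mono hA hB) (fun _ => parallelSum_isPositive _ _)
    fun _ => parallelSum_le _ _

/-- The generalized short `[A]B = sup_n (B : nA)` of `B` with respect to `A`, the supremum being
taken in the order of operators. -/
noncomputable def generalizedShort (hA : A.IsPositive) (hB : B.IsPositive) : H →L[ℂ] H :=
  (exists_isLUB_parallelSum hA hB).choose

theorem isLUB_generalizedShort (hA : A.IsPositive) (hB : B.IsPositive) :
    IsLUB (Set.range fun n : ℕ => parallelSum hB (nsmul_isPositive hA n))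
      (generalizedShort hA hB) :=
  (exists_isLUB_parallelSum hA hB).choose_spec

/-- The set `Q(B)` of `B`-quasi-units: the operators `A` with `0 ≤ A ≤ B` and `[A]B = A`. -/
def quasiUnits (hB : B.IsPositive) : Set (H →L[ℂ] H) :=
  {A | ∃ hA : A.IsPositive, A ≤ B ∧ generalizedShort hA hB = A}

end ParallelSum

end QuasiUnit

/-!
Throughout, `J_B J_B^* = B`, the operator `J_B^*` has dense range and `J_B` is injective. The form
of `Ψ_B(T)` at `x` is the form of `T` at `J_B^* x`, so density makes `Ψ_B` an order embedding
(`Psi_le_Psi_iff`). With the Douglas factorization (`exists_Psi_eq`) it is an affine bijection of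
`[0, 1]` onto `[0, B]`. The extreme points of `[0, 1]` are the projections, hence those of `[0, B]`
are the operators `Ψ_B(P)`.

It remains to identify `[A]B`, and this is `generalizedShort_eq_Psi`: if `A = R R^*`, then
`[A]B = Ψ_B(P)` with `P` the projection onto the closure of `D = J_B⁻¹(ran R)`. With `ξ = J_B^* x`,
the form of `B : nA` at `x` is `inf_y (‖ξ - J_B^* y‖² + n ‖R^* y‖²)`.

* It is at most `‖P ξ‖²`: since `ξ - P ξ` is orthogonal to `D`, the pair `(ξ - P ξ, 0)` is a limit
  of pairs `(J_B^* y, R^* y)` (`exists_adjoint_approx`).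
* If `J_B w = R h`, it is at least `2 Re ⟨w, ξ⟩ - ‖w‖² - ‖h‖² / n` (`le_norm_sub_sq_add`). Letting
  `n → ∞` and then `w → P ξ` within `D` gives `‖P ξ‖²`.

So every `[A]B` has the form `Ψ_B(P)`. Conversely, `Ψ_B(P) = (J_B P)(J_B P)^*` and
`J_B⁻¹(ran (J_B P)) = ran P` is closed, so `[Ψ_B(P)]B = Ψ_B(P)` (`generalizedShort_Psi`). Therefore
the quasi-units, the operators `[A]B` and the operators `Ψ_B(P)` are the same.
-/

namespace QuasiUnit

/-! ### Operators of the form `R R^*` -/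

section Factorization

open ContinuousLinearMap

variable {H K L : Type*} [NormedAddCommGroup H] [InnerProductSpace ℂ H] [CompleteSpace H]
  [NormedAddCommGroup K] [InnerProductSpace ℂ K] [CompleteSpace K]
  [NormedAddCommGroup L] [InnerProductSpace ℂ L] [CompleteSpace L]

theorem reApplyInnerSelf_comp_adjoint (R : L →L[ℂ] H) (x : H) :
    (R ∘L R.adjoint).reApplyInnerSelf x = ‖R.adjoint x‖ ^ 2 := by
  rw [reApplyInnerSelf_apply, comp_apply, ← adjoint_inner_right, inner_self_eq_norm_sq]

theorem reApplyInnerSelf_le_of_le {C D : H →L[ℂ] H} (h : C ≤ D) (x : H) :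
    C.reApplyInnerSelf x ≤ D.reApplyInnerSelf x := by
  have h0 := ((le_def _ _).1 h).re_inner_nonneg_left x
  rw [sub_apply, inner_sub_left, map_sub] at h0
  exact sub_nonneg.1 h0

theorem reApplyInnerSelf_nsmul (A : H →L[ℂ] H) (n : ℕ) (x : H) :
    (n • A).reApplyInnerSelf x = n * A.reApplyInnerSelf x := by
  simp [reApplyInnerSelf_apply, ← Nat.cast_smul_eq_nsmul ℂ, inner_smul_left]

/-- If `ξ` is orthogonal to every `w` with `S w ∈ ran R`, then `(ξ, 0)` lies in the closure of
`{(S^* y, R^* y) | y ∈ H}`: the orthogonal complement of that subspace of `K × L` consists of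
the pairs `(w, h)` with `S w = -R h`. -/
theorem exists_adjoint_approx (S : K →L[ℂ] H) (R : L →L[ℂ] H) {ξ : K}
    (hξ : ξ ∈ ((LinearMap.range R.toLinearMap).comap S.toLinearMap)ᗮ) {ε : ℝ} (hε : 0 < ε) :
    ∃ y : H, ‖ξ - S.adjoint y‖ < ε ∧ ‖R.adjoint y‖ < ε := by
  let e := (WithLp.prodContinuousLinearEquiv 2 ℂ K L).symm.toContinuousLinearMap
  let v : H →L[ℂ] WithLp 2 (K × L) := e ∘L (S.adjoint.prod R.adjoint)
  have hmem : WithLp.toLp 2 (ξ, (0 : L)) ∈ (LinearMap.range v.toLinearMap).topologicalClosure := by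
    rw [← Submodule.orthogonal_orthogonal_eq_closure, Submodule.mem_orthogonal]
    intro z hz
    have hz' : S z.fst + R z.snd = 0 := by
      refine ext_inner_left ℂ fun y => ?_
      have := (Submodule.mem_orthogonal _ _).1 hz (v y) ⟨y, rfl⟩
      rw [WithLp.prod_inner_apply] at this
      simpa [v, e, adjoint_inner_left, inner_add_right] using this
    have hw : z.fst ∈ (LinearMap.range R.toLinearMap).comap S.toLinearMap :=
      ⟨-z.snd, by simpa using (eq_neg_of_add_eq_zero_left hz').symm⟩
    rw [WithLp.prod_inner_apply]
    simpa using (Submodule.mem_orthogonal _ _).1 hξ _ hw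
  have hcl : WithLp.toLp 2 (ξ, (0 : L)) ∈ closure (Set.range v) := hmem
  obtain ⟨_, ⟨y, rfl⟩, hy⟩ := Metric.mem_closure_iff.1 hcl ε hε
  rw [dist_eq_norm] at hy
  refine ⟨y, ?_, ?_⟩
  · refine lt_of_le_of_lt ?_ hy
    simpa [v, e] using WithLp.norm_fst_le _ (WithLp.toLp 2 (ξ, (0 : L)) - v y)
  · refine lt_of_le_of_lt ?_ hy
    simpa [v, e] using WithLp.norm_snd_le _ (WithLp.toLp 2 (ξ, (0 : L)) - v y)

/-- The dual lower bound for the quadratic form defining a parallel sum, obtained from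
`‖a‖ ^ 2 ≥ 2 Re ⟨w, a⟩ - ‖w‖ ^ 2` and `t ‖r‖ ^ 2 ≥ 2 Re ⟨h, r⟩ - ‖h‖ ^ 2 / t`. -/
theorem le_norm_sub_sq_add {S : K →L[ℂ] H} {R : L →L[ℂ] H} {w : K} {h : L} (hwh : R h = S w)
    (ξ : K) (y : H) {t : ℝ} (ht : 0 < t) :
    2 * RCLike.re (inner ℂ w ξ) - ‖w‖ ^ 2 - ‖h‖ ^ 2 / t ≤
      ‖ξ - S.adjoint y‖ ^ 2 + t * ‖R.adjoint y‖ ^ 2 := by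
  have h1 : RCLike.re (inner ℂ w (S.adjoint y)) ≤ ‖h‖ * ‖R.adjoint y‖ := by
    rw [adjoint_inner_right, ← hwh, ← adjoint_inner_right]
    exact re_inner_le_norm _ _
  have h2 := norm_sub_sq (𝕜 := ℂ) w (ξ - S.adjoint y)
  rw [inner_sub_right, map_sub] at h2
  have h3 : ‖h‖ ^ 2 / t * t = ‖h‖ ^ 2 := div_mul_cancel₀ _ ht.ne'
  have h4 : 2 * (‖h‖ * ‖R.adjoint y‖) ≤ ‖h‖ ^ 2 / t + t * ‖R.adjoint y‖ ^ 2 := by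
    have : 0 ≤ (‖h‖ - t * ‖R.adjoint y‖) ^ 2 / t := by positivity
    have h5 : (‖h‖ - t * ‖R.adjoint y‖) ^ 2 / t =
        ‖h‖ ^ 2 / t - 2 * (‖h‖ * ‖R.adjoint y‖) + t * ‖R.adjoint y‖ ^ 2 := by
      field_simp
      ring
    linarith
  nlinarith [sq_nonneg ‖w - (ξ - S.adjoint y)‖]

end Factorization

/-! ### The operator `J_B` and the map `Ψ_B` -/

section PsiMap

open ContinuousLinearMap

variable {H : Type*} [NormedAddCommGroup H] [InnerProductSpace ℂ H] [CompleteSpace H]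
  (B : H →L[ℂ] H) (hB : B.IsPositive)

theorem denseRange_adjoint_J : DenseRange (J B hB).adjoint := by
  have h : ⇑(J B hB).adjoint = (fun v : RangeSpace B hB => (v : AuxSpace B hB)) ∘
      RangeSpace.mk B hB := funext (J_adjoint_apply B hB)
  rw [h]
  exact UniformSpace.Completion.denseRange_coe.comp (RangeSpace.mk_surjective B hB).denseRange
    (UniformSpace.Completion.continuous_coe _)

theorem J_injective : Function.Injective (J B hB) := by
  refine (injective_iff_map_eq_zero _).2 fun ξ hξ => ?_
  refine (denseRange_adjoint_J B hB).eq_zero_of_inner_left ℂ fun x => ?_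
  rw [adjoint_inner_right, hξ, inner_zero_left]

theorem norm_adjoint_J_sq (x : H) : ‖(J B hB).adjoint x‖ ^ 2 = B.reApplyInnerSelf x := by
  rw [← reApplyInnerSelf_comp_adjoint, J_comp_adjoint]

theorem Psi_one : Psi B hB 1 = B := J_comp_adjoint B hB

theorem Psi_zero : Psi B hB 0 = 0 := by
  ext x
  simp [Psi]

theorem Psi_isPositive {T : AuxSpace B hB →L[ℂ] AuxSpace B hB} (hT : T.IsPositive) :
    (Psi B hB T).IsPositive :=
  hT.conj_adjoint _

theorem Psi_sub (S T : AuxSpace B hB →L[ℂ] AuxSpace B hB) :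
    Psi B hB (S - T) = Psi B hB S - Psi B hB T := by
  ext x
  simp [Psi]

/-- `Ψ_B` as a real-linear map. -/
noncomputable def PsiLinear :
    (AuxSpace B hB →L[ℂ] AuxSpace B hB) →ₗ[ℝ] (H →L[ℂ] H) where
  toFun := Psi B hB
  map_add' S T := by ext x; simp [Psi]
  map_smul' c T := by ext x; simp [Psi]

/-- `Ψ_B` reflects positivity, because `J_B^*` has dense range. -/
theorem isPositive_of_Psi {T : AuxSpace B hB →L[ℂ] AuxSpace B hB}
    (hT : (Psi B hB T).IsPositive) : T.IsPositive := by
  rw [isPositive_iff_complex] at hT ⊢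
  intro ξ
  induction ξ using (denseRange_adjoint_J B hB).induction_on with
  | hp =>
    have hc : Continuous fun ξ => inner ℂ (T ξ) ξ := by fun_prop
    have hre := Complex.continuous_re.comp hc
    exact (isClosed_eq (Complex.continuous_ofReal.comp hre) hc).inter
      (isClosed_le continuous_const hre)
  | ih x =>
    have h := hT x
    rwa [Psi, comp_apply, comp_apply, ← adjoint_inner_right] at h

theorem Psi_le_Psi_iff (S T : AuxSpace B hB →L[ℂ] AuxSpace B hB) :
    Psi B hB S ≤ Psi B hB T ↔ S ≤ T := by
  rw [ContinuousLinearMap.le_def, ContinuousLinearMap.le_def, ← Psi_sub]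
  exact ⟨isPositive_of_Psi B hB, Psi_isPositive B hB⟩

theorem Psi_injective : Function.Injective (Psi B hB) := fun S T h =>
  le_antisymm ((Psi_le_Psi_iff B hB S T).1 h.le) ((Psi_le_Psi_iff B hB T S).1 h.ge)

/-- Douglas factorization: for `0 ≤ A ≤ B` the map `J_B^* x ↦ J_A^* x` extends to a contraction
`W` with `A = Ψ_B(W^* W)`. -/
theorem exists_Psi_eq {A : H →L[ℂ] H} (h0 : 0 ≤ A) (h1 : A ≤ B) :
    ∃ T : AuxSpace B hB →L[ℂ] AuxSpace B hB, Psi B hB T = A := by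
  have hA := (nonneg_iff_isPositive A).1 h0
  have hle : ∀ x, ‖(J A hA).adjoint.toLinearMap x‖ ≤ 1 * ‖(J B hB).adjoint.toLinearMap x‖ := by
    intro x
    rw [one_mul]
    refine (pow_le_pow_iff_left₀ (norm_nonneg _) (norm_nonneg _) two_ne_zero).1 ?_
    simpa only [coe_coe, norm_adjoint_J_sq] using reApplyInnerSelf_le_of_le h1 x
  let W := (J A hA).adjoint.toLinearMap.extendOfNorm (J B hB).adjoint.toLinearMap
  have hW : W ∘L (J B hB).adjoint = (J A hA).adjoint := ContinuousLinearMap.ext fun x =>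
    LinearMap.extendOfNorm_eq (denseRange_adjoint_J B hB) ⟨1, hle⟩ x
  refine ⟨W.adjoint ∘L W, ?_⟩
  have hW' : J B hB ∘L W.adjoint = J A hA := by
    rw [← adjoint_adjoint (J A hA), ← hW, adjoint_comp, adjoint_adjoint]
  rw [Psi, comp_assoc, hW, ← comp_assoc, hW', J_comp_adjoint]

theorem image_Psi_Icc : Psi B hB '' Set.Icc 0 1 = Set.Icc 0 B := by
  have h0 := fun T => Psi_le_Psi_iff B hB 0 T
  have h1 := fun T => Psi_le_Psi_iff B hB T 1
  rw [Psi_zero] at h0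
  rw [Psi_one] at h1
  ext A
  refine ⟨?_, fun hA => ?_⟩
  · rintro ⟨T, hT, rfl⟩
    exact ⟨(h0 T).2 hT.1, (h1 T).2 hT.2⟩
  · obtain ⟨T, rfl⟩ := exists_Psi_eq B hB hA.1 hA.2
    exact ⟨T, ⟨(h0 T).1 hA.1, (h1 T).1 hA.2⟩, rfl⟩

end PsiMap

/-! ### The generalized short as the image of a projection -/

section GeneralizedShort

open ContinuousLinearMap

variable {H L : Type*} [NormedAddCommGroup H] [InnerProductSpace ℂ H] [CompleteSpace H]
  [NormedAddCommGroup L] [InnerProductSpace ℂ L] [CompleteSpace L]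
  (B : H →L[ℂ] H) (hB : B.IsPositive)

theorem Psi_eq_comp_adjoint {P : AuxSpace B hB →L[ℂ] AuxSpace B hB} (hP : IsStarProjection P) :
    (J B hB ∘L P) ∘L (J B hB ∘L P).adjoint = Psi B hB P := by
  rw [adjoint_comp, hP.isSelfAdjoint.adjoint_eq, comp_assoc, ← comp_assoc P, Psi]
  congr 2
  exact hP.isIdempotentElem

/-- The subspace of those `w ∈ H_B` for which `J_B w` lies in the range of `R`. -/
noncomputable def comapRange (R : L →L[ℂ] H) : Submodule ℂ (AuxSpace B hB) :=
  (LinearMap.range R.toLinearMap).comap (J B hB).toLinearMap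

theorem reApplyInnerSelf_Psi_starProjection (M : Submodule ℂ (AuxSpace B hB))
    [M.HasOrthogonalProjection] (x : H) :
    (Psi B hB M.starProjection).reApplyInnerSelf x =
      ‖M.starProjection ((J B hB).adjoint x)‖ ^ 2 := by
  rw [← Psi_eq_comp_adjoint B hB isStarProjection_starProjection, reApplyInnerSelf_comp_adjoint,
    adjoint_comp, comp_apply, (isSelfAdjoint_starProjection M).adjoint_eq]

theorem reApplyInnerSelf_parallelSum_nsmul {A : H →L[ℂ] H} (hA : A.IsPositive) {R : L →L[ℂ] H}
    (hR : R ∘L R.adjoint = A) (n : ℕ) (x : H) :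
    (parallelSum hB (nsmul_isPositive hA n)).reApplyInnerSelf x =
      ⨅ y : H, (‖(J B hB).adjoint x - (J B hB).adjoint y‖ ^ 2 + n * ‖R.adjoint y‖ ^ 2) := by
  rw [reApplyInnerSelf_parallelSum]
  refine iInf_congr fun y => ?_
  rw [← map_sub, norm_adjoint_J_sq, reApplyInnerSelf_nsmul, ← hR, reApplyInnerSelf_comp_adjoint]

/-- For `A = R R^*`, the operator `[A]B` is the image under `Ψ_B` of the projection onto the
closure of `J_B⁻¹(ran R)`. -/
theorem generalizedShort_eq_Psi {A : H →L[ℂ] H} (hA : A.IsPositive) {R : L →L[ℂ] H}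
    (hR : R ∘L R.adjoint = A) :
    generalizedShort hA hB =
      Psi B hB (comapRange B hB R).topologicalClosure.starProjection := by
  set M := (comapRange B hB R).topologicalClosure with hM
  have hP : (Psi B hB M.starProjection).IsPositive :=
    Psi_isPositive B hB (.of_isStarProjection isStarProjection_starProjection)
  refine (isLUB_generalizedShort hA hB).unique ⟨?_, fun D hD => ?_⟩
  · rintro _ ⟨n, rfl⟩
    refine le_of_reApplyInnerSelf_le (parallelSum_isPositive _ _) hP fun x => ?_
    rw [reApplyInnerSelf_Psi_starProjection]
    set ξ := (J B hB).adjoint x with hξ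
    set p := M.starProjection ξ
    have hbound : ∀ ε : ℝ, 0 < ε →
        (parallelSum hB (nsmul_isPositive hA n)).reApplyInnerSelf x ≤
          (‖p‖ + ε) ^ 2 + n * ε ^ 2 := by
      intro ε hε
      have hmem : ξ - p ∈ (comapRange B hB R)ᗮ := by
        rw [← Submodule.orthogonal_closure]
        exact Submodule.sub_starProjection_mem_orthogonal _
      obtain ⟨y, hy1, hy2⟩ := exists_adjoint_approx (J B hB) R hmem hε
      have hbdd := bddBelow_parallelSum hB (nsmul_isPositive hA n) x
      rw [reApplyInnerSelf_parallelSum]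
      refine (ciInf_le hbdd y).trans ?_
      rw [← norm_adjoint_J_sq B hB, map_sub, reApplyInnerSelf_nsmul, ← hR,
        reApplyInnerSelf_comp_adjoint]
      have h1 : ‖ξ - (J B hB).adjoint y‖ ≤ ‖p‖ + ε := by
        have : ξ - (J B hB).adjoint y = p + (ξ - p - (J B hB).adjoint y) := by abel
        rw [this]
        exact (norm_add_le _ _).trans (by gcongr)
      gcongr
    have hlim : Tendsto (fun ε : ℝ => (‖p‖ + ε) ^ 2 + n * ε ^ 2) (𝓝[>] 0) (𝓝 (‖p‖ ^ 2)) := by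
      have hc : Continuous fun ε : ℝ => (‖p‖ + ε) ^ 2 + n * ε ^ 2 := by fun_prop
      simpa using (hc.tendsto 0).mono_left nhdsWithin_le_nhds
    exact ge_of_tendsto hlim (eventually_nhdsWithin_of_forall hbound)
  · have hD0 : D.IsPositive := (nonneg_iff_isPositive _).1
      (((nonneg_iff_isPositive _).2 (parallelSum_isPositive hB (nsmul_isPositive hA 0))).trans
        (hD ⟨0, rfl⟩))
    refine le_of_reApplyInnerSelf_le hP hD0 fun x => ?_
    rw [reApplyInnerSelf_Psi_starProjection]
    set ξ := (J B hB).adjoint x with hξ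
    have hbound : ∀ w ∈ comapRange B hB R,
        2 * RCLike.re (inner ℂ w ξ) - ‖w‖ ^ 2 ≤ D.reApplyInnerSelf x := by
      rintro w ⟨h, hw⟩
      have hlim : Tendsto (fun n : ℕ => 2 * RCLike.re (inner ℂ w ξ) - ‖w‖ ^ 2 -
          ‖h‖ ^ 2 / ((n + 1 : ℕ) : ℝ)) atTop (𝓝 (2 * RCLike.re (inner ℂ w ξ) - ‖w‖ ^ 2 - 0)) :=
        tendsto_const_nhds.sub ((tendsto_const_div_atTop_nhds_zero_nat (‖h‖ ^ 2)).comp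
          (tendsto_add_atTop_nat 1))
      rw [sub_zero] at hlim
      refine le_of_tendsto' hlim fun n => le_trans ?_
        (reApplyInnerSelf_le_of_le (hD ⟨n + 1, rfl⟩) x)
      rw [reApplyInnerSelf_parallelSum_nsmul B hB hA hR]
      exact le_ciInf fun y => le_norm_sub_sq_add hw ξ y (by positivity)
    have hclosed : IsClosed {w : AuxSpace B hB |
        2 * RCLike.re (inner ℂ w ξ) - ‖w‖ ^ 2 ≤ D.reApplyInnerSelf x} :=
      isClosed_le (by fun_prop) continuous_const
    -- The bound is optimal at `w = P ξ`, where its left-hand side is `‖P ξ‖ ^ 2`.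
    have hp : 2 * RCLike.re (inner ℂ (M.starProjection ξ) ξ) - ‖M.starProjection ξ‖ ^ 2 ≤
        D.reApplyInnerSelf x :=
      hclosed.closure_subset_iff.2 hbound (Submodule.starProjection_apply_mem M ξ)
    have hpp : RCLike.re (inner ℂ (M.starProjection ξ) ξ) = ‖M.starProjection ξ‖ ^ 2 := by
      have h := Submodule.starProjection_eq_self_iff.2 (Submodule.starProjection_apply_mem M ξ)
      rw [← h, Submodule.inner_starProjection_left_eq_right, h, inner_self_eq_norm_sq]
    linarith

/-- For `A = Ψ_B(P) = (J_B P)(J_B P)^*` the subspace `J_B⁻¹(ran (J_B P))` is `ran P`, since `J_B`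
is injective. -/
theorem generalizedShort_Psi {P : AuxSpace B hB →L[ℂ] AuxSpace B hB} (hP : IsStarProjection P)
    (hA : (Psi B hB P).IsPositive) : generalizedShort hA hB = Psi B hB P := by
  obtain ⟨M, _, rfl⟩ := isStarProjection_iff_eq_starProjection.1 hP
  have hMc : IsClosed (M : Set (AuxSpace B hB)) := by
    rw [← Submodule.orthogonal_orthogonal M]
    exact Submodule.isClosed_orthogonal _
  have hrange : comapRange B hB (J B hB ∘L M.starProjection) = M := by
    ext w
    refine ⟨?_, fun hw => ⟨w, by simp [Submodule.starProjection_eq_self_iff.2 hw]⟩⟩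
    rintro ⟨z, hz⟩
    rw [← J_injective B hB hz]
    exact Submodule.starProjection_apply_mem M z
  rw [generalizedShort_eq_Psi B hB hA (Psi_eq_comp_adjoint B hB hP)]
  congr 1
  rw [Submodule.starProjection_inj, hrange]
  exact hMc.submodule_topologicalClosure_eq

theorem exists_generalizedShort_eq_Psi {A : H →L[ℂ] H} (hA : A.IsPositive) :
    ∃ P ∈ projections (AuxSpace B hB), Psi B hB P = generalizedShort hA hB :=
  ⟨_, isStarProjection_starProjection, (generalizedShort_eq_Psi B hB hA (J_comp_adjoint A hA)).symm⟩

end GeneralizedShort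

/-! ### Quasi-units and extreme points -/

section QuasiUnits

open ContinuousLinearMap

variable {H : Type*} [NormedAddCommGroup H] [InnerProductSpace ℂ H] [CompleteSpace H]
  (B : H →L[ℂ] H) (hB : B.IsPositive)

theorem Psi_mem_quasiUnits {P : AuxSpace B hB →L[ℂ] AuxSpace B hB} (hP : IsStarProjection P) :
    Psi B hB P ∈ quasiUnits hB := by
  have hA : (Psi B hB P).IsPositive := Psi_isPositive B hB (.of_isStarProjection hP)
  refine ⟨hA, ?_, generalizedShort_Psi B hB hP hA⟩
  conv_rhs => rw [← Psi_one B hB]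
  exact (Psi_le_Psi_iff B hB _ _).2 hP.le_one

theorem image_Psi_projections :
    Psi B hB '' projections (AuxSpace B hB) = quasiUnits hB := by
  refine Set.Subset.antisymm ?_ ?_
  · rintro _ ⟨P, hP, rfl⟩
    exact Psi_mem_quasiUnits B hB hP
  · rintro A ⟨hA, -, h⟩
    rw [← h]
    exact exists_generalizedShort_eq_Psi B hB hA

theorem quasiUnits_eq_setOf_generalizedShort :
    quasiUnits hB = {C | ∃ (A : H →L[ℂ] H) (hA : A.IsPositive), C = generalizedShort hA hB} := by
  refine Set.Subset.antisymm ?_ ?_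
  · rintro A ⟨hA, -, h⟩
    exact ⟨A, hA, h.symm⟩
  · rintro _ ⟨A, hA, rfl⟩
    obtain ⟨P, hP, h⟩ := exists_generalizedShort_eq_Psi B hB hA
    rw [← h]
    exact Psi_mem_quasiUnits B hB hP

theorem projections_eq_extremePoints (K : Type*) [NormedAddCommGroup K] [InnerProductSpace ℂ K]
    [CompleteSpace K] : projections K = Set.extremePoints ℝ (Set.Icc (0 : K →L[ℂ] K) 1) := by
  have h : Set.Icc (0 : K →L[ℂ] K) 1 = {T | 0 ≤ T} ∩ Metric.closedBall 0 1 := by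
    ext T
    simp only [Set.mem_Icc, Set.mem_inter_iff, Set.mem_ofPred_eq, mem_closedBall_zero_iff]
    exact and_congr_right fun hT => (CStarAlgebra.norm_le_one_iff_of_nonneg T hT).symm
  ext P
  rw [h, ← isStarProjection_iff_mem_extremePoints_setOfPred_nonneg_inter_unitClosedBall]
  rfl

theorem image_Psi_extremePoints (s : Set (AuxSpace B hB →L[ℂ] AuxSpace B hB)) :
    Psi B hB '' Set.extremePoints ℝ s = Set.extremePoints ℝ (Psi B hB '' s) := by
  have hseg : ∀ S T, openSegment ℝ (Psi B hB S) (Psi B hB T) = Psi B hB '' openSegment ℝ S T :=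
    fun S T => (image_openSegment ℝ (PsiLinear B hB).toAffineMap S T).symm
  have hi := Psi_injective B hB
  ext A
  constructor
  · rintro ⟨T, hT, rfl⟩
    rw [mem_extremePoints] at hT ⊢
    refine ⟨⟨T, hT.1, rfl⟩, ?_⟩
    rintro _ ⟨S₁, h₁, rfl⟩ _ ⟨S₂, h₂, rfl⟩ h
    rw [hseg, hi.mem_set_image] at h
    simpa only [hi.eq_iff] using hT.2 S₁ h₁ S₂ h₂ h
  · intro hA
    obtain ⟨⟨T, hT, rfl⟩, h⟩ := mem_extremePoints.1 hA
    refine ⟨T, mem_extremePoints.2 ⟨hT, fun S₁ h₁ S₂ h₂ hS => ?_⟩, rfl⟩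
    simpa only [hi.eq_iff] using h _ ⟨S₁, h₁, rfl⟩ _ ⟨S₂, h₂, rfl⟩
      (by rw [hseg]; exact ⟨T, hS, rfl⟩)

theorem quasiUnits_eq_extremePoints :
    quasiUnits hB = Set.extremePoints ℝ (Set.Icc 0 B) := by
  rw [← image_Psi_projections B hB, projections_eq_extremePoints, image_Psi_extremePoints,
    image_Psi_Icc]

end QuasiUnits

end QuasiUnit

theorem mainTheorem2 {H : Type*} [NormedAddCommGroup H] [InnerProductSpace ℂ H] [CompleteSpace H]
    (B : H →L[ℂ] H) (hB : B.IsPositive) :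
    Set.BijOn (QuasiUnit.Psi B hB) (QuasiUnit.projections (QuasiUnit.AuxSpace B hB))
      (QuasiUnit.quasiUnits hB) ∧
    (∀ P ∈ QuasiUnit.projections (QuasiUnit.AuxSpace B hB),
      ∀ Q ∈ QuasiUnit.projections (QuasiUnit.AuxSpace B hB),
        P ≤ Q ↔ QuasiUnit.Psi B hB P ≤ QuasiUnit.Psi B hB Q) ∧
    QuasiUnit.quasiUnits hB = Set.extremePoints ℝ (Set.Icc 0 B) ∧
    QuasiUnit.quasiUnits hB =
      {C | ∃ (A : H →L[ℂ] H) (hA : A.IsPositive), C = QuasiUnit.generalizedShort hA hB} := by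
  refine ⟨?_, fun P _ Q _ => (QuasiUnit.Psi_le_Psi_iff B hB P Q).symm,
    QuasiUnit.quasiUnits_eq_extremePoints B hB,
    QuasiUnit.quasiUnits_eq_setOf_generalizedShort B hB⟩
  rw [← QuasiUnit.image_Psi_projections B hB]
  exact (QuasiUnit.Psi_injective B hB).injOn.bijOn_image
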